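/- Let Sol space be $\mathbb R^3$ with the Riemannian metric $g_{Sol}=e^{2z}dx^2+e^{-2z}dy^2+dz^2$. Let $(N^2,h)$ be any smooth Riemannian surface (a smooth $2$-manifold without boundary with a smooth Riemannian metric). Then there is no harmonic Riemannian submersion $\pi:(\mathbb R^3,g_{Sol})\to(N^2,h)$. That is, no smooth map $\pi:\mathbb R^3\to N$ has both of the following properties: (i) $\pi$ is a Riemannian submersion: for every $p\in\mathbb R^3$ the differential $d\pi_p$ is surjective, and $h(d\pi_p X,d\pi_p Y)=g_{Sol}(X,Y)$ for all $X,Y\in T_p\mathbb R^3$ that are $g_{Sol}$-orthogonal to $\ker d\pi_p$ (the map $\pi$ itself may be surjective or not); (ii) $\pi$ is a harmonic map: its tension field $\tau(\pi)=\operatorname{Trace}_{g_{Sol}}\nabla d\pi$ vanishes identically on $\mathbb R^3$. -/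

import Mathlib

open scoped Manifold ContDiff

-- The charted space structure on `ℝⁿ` is the one with the identity as its only chart.
attribute [instance 2000] chartedSpaceSelf
attribute [instance 2000] instIsManifoldModelSpace

noncomputable section

namespace SolSubmersion

/-- The coordinate space `ℝⁿ`. -/
abbrev Coord (n : ℕ) : Type := EuclideanSpace ℝ (Fin n)

/-- The `i`-th standard basis vector of `ℝⁿ`. -/
def stdVec {n : ℕ} (i : Fin n) : Coord n := EuclideanSpace.single i 1

/-- The partial derivative `∂F/∂uⁱ` of a real function on (an open part of) `ℝⁿ`. -/
def pderiv {n : ℕ} (i : Fin n) (F : Coord n → ℝ) (u : Coord n) : ℝ :=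
  fderiv ℝ F u (stdVec i)

/-- A smooth Riemannian metric on a smooth `n`-manifold `M` without boundary. -/
abbrev Metric (n : ℕ) (M : Type*) [TopologicalSpace M] [ChartedSpace (Coord n) M]
    [IsManifold (𝓡 n) ∞ M] :=
  Bundle.ContMDiffRiemannianMetric (𝓡 n) ∞ (Coord n) (fun x : M => TangentSpace (𝓡 n) x)

section Local

variable {n : ℕ} {M : Type*} [TopologicalSpace M] [ChartedSpace (Coord n) M]
  [IsManifold (𝓡 n) ∞ M]

/-- The coordinate vector `∂ᵢ` of the chart `e`, at the point with coordinates `u ∈ e.target`. -/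
def coordVec (e : OpenPartialHomeomorph M (Coord n)) (i : Fin n) (u : Coord n) :
    TangentSpace (𝓡 n) (e.symm u) :=
  mfderiv (𝓡 n) (𝓡 n) e.symm u (stdVec i : Coord n)

/-- The matrix `gᵢⱼ = g(∂ᵢ, ∂ⱼ)` of the metric `g` in the chart `e`, as a function of the
coordinates. -/
def metricMatrix (g : Metric n M) (e : OpenPartialHomeomorph M (Coord n)) (u : Coord n) :
    Matrix (Fin n) (Fin n) ℝ :=
  Matrix.of fun i j => g.inner (e.symm u) (coordVec e i u) (coordVec e j u)

/-- The Christoffel symbol `Γᵏᵢⱼ = ½ ∑ₗ gᵏˡ (∂ᵢ gⱼₗ + ∂ⱼ gᵢₗ - ∂ₗ gᵢⱼ)` of the Levi-Civita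
connection of `g` in the chart `e`. -/
def christoffel (g : Metric n M) (e : OpenPartialHomeomorph M (Coord n)) (k i j : Fin n)
    (u : Coord n) : ℝ :=
  (1 / 2 : ℝ) * ∑ l : Fin n, (metricMatrix g e u)⁻¹ k l *
    (pderiv i (fun v => metricMatrix g e v j l) u
      + pderiv j (fun v => metricMatrix g e v i l) u
      - pderiv l (fun v => metricMatrix g e v i j) u)

end Local

section Maps

variable {m n : ℕ}
  {M : Type*} [TopologicalSpace M] [ChartedSpace (Coord m) M] [IsManifold (𝓡 m) ∞ M]
  {N : Type*} [TopologicalSpace N] [ChartedSpace (Coord n) N] [IsManifold (𝓡 n) ∞ N]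

/-- The component `φᵅ` of the map `φ` read in the charts `e` of `M` and `e'` of `N`. -/
def localRep (φ : M → N) (e : OpenPartialHomeomorph M (Coord m))
    (e' : OpenPartialHomeomorph N (Coord n)) (α : Fin n) (u : Coord m) : ℝ :=
  e' (φ (e.symm u)) α

/-- The component `(∇dφ)ᵅᵢⱼ` of the second fundamental form of `φ : (M, g) → (N, h)` in the
charts `e`, `e'`, at the point of `M` with coordinates `u`:
`∂ᵢ∂ⱼφᵅ - ∑ₖ Γᵏᵢⱼ ∂ₖφᵅ + ∑_{β,γ} Γ'ᵅ_{βγ}(φ) ∂ᵢφᵝ ∂ⱼφᵞ`. -/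
def secondFundForm (g : Metric m M) (h : Metric n N) (φ : M → N)
    (e : OpenPartialHomeomorph M (Coord m)) (e' : OpenPartialHomeomorph N (Coord n))
    (α : Fin n) (i j : Fin m) (u : Coord m) : ℝ :=
  pderiv i (fun v => pderiv j (localRep φ e e' α) v) u
    - ∑ k : Fin m, christoffel g e k i j u * pderiv k (localRep φ e e' α) u
    + ∑ β : Fin n, ∑ γ : Fin n, christoffel h e' α β γ (e' (φ (e.symm u)))
        * pderiv i (localRep φ e e' β) u * pderiv j (localRep φ e e' γ) u

/-- The component `τ(φ)ᵅ = ∑_{i,j} gⁱʲ (∇dφ)ᵅᵢⱼ` of the tension field `τ(φ) = Trace_g ∇dφ`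
in the charts `e`, `e'`. -/
def tension (g : Metric m M) (h : Metric n N) (φ : M → N)
    (e : OpenPartialHomeomorph M (Coord m)) (e' : OpenPartialHomeomorph N (Coord n))
    (α : Fin n) (u : Coord m) : ℝ :=
  ∑ i : Fin m, ∑ j : Fin m, (metricMatrix g e u)⁻¹ i j * secondFundForm g h φ e e' α i j u

/-- A smooth map `φ : (M, g) → (N, h)` is harmonic if its tension field vanishes identically.
The tension field is a tensorial object (a section of `φ^*TN`), so that the vanishing of its
components at a point does not depend on the charts of the atlases around the point and its
image. -/
structure IsHarmonicMap (g : Metric m M) (h : Metric n N) (φ : M → N) : Prop where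
  smooth : ContMDiff (𝓡 m) (𝓡 n) ∞ φ
  tension_eq_zero : ∀ e ∈ atlas (Coord m) M, ∀ e' ∈ atlas (Coord n) N,
    ∀ p ∈ e.source, φ p ∈ e'.source → ∀ α : Fin n, tension g h φ e e' α (e p) = 0

/-- The tangent vector `X` at `p` is horizontal for `φ : (M, g) → N`: it is `g`-orthogonal to
every vertical vector, i.e. to the kernel of `dφₚ`. -/
def IsHorizontal (g : Metric m M) (φ : M → N) (p : M) (X : TangentSpace (𝓡 m) p) : Prop :=
  ∀ V : TangentSpace (𝓡 m) p, mfderiv (𝓡 m) (𝓡 n) φ p V = 0 → g.inner p X V = 0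

/-- `φ : (M, g) → (N, h)` is a Riemannian submersion: a smooth submersion whose differentials
preserve the inner products of horizontal vectors. Surjectivity of `φ` itself is not
required. -/
structure IsRiemannianSubmersion (g : Metric m M) (h : Metric n N) (φ : M → N) : Prop where
  smooth : ContMDiff (𝓡 m) (𝓡 n) ∞ φ
  surjective_mfderiv : ∀ p : M, Function.Surjective (mfderiv (𝓡 m) (𝓡 n) φ p)
  isometry_horizontal : ∀ (p : M) (X Y : TangentSpace (𝓡 m) p),
    IsHorizontal (n := n) g φ p X → IsHorizontal (n := n) g φ p Y →
      h.inner (φ p) (mfderiv (𝓡 m) (𝓡 n) φ p X) (mfderiv (𝓡 m) (𝓡 n) φ p Y) = g.inner p X Y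

end Maps

section VectorSpace

variable {E : Type*} [NormedAddCommGroup E] [NormedSpace ℝ E]

/-- The bilinear form `s a² + t b² + c²` on a vector space, for linear forms `a`, `b`, `c` and
real numbers `s`, `t`. -/
def diagForm (a b c : E →L[ℝ] ℝ) (s t : ℝ) : E →L[ℝ] E →L[ℝ] ℝ :=
  s • a.smulRight a + t • b.smulRight b + c.smulRight c

theorem contDiff_smul_left {F : Type*} [NormedAddCommGroup F] [NormedSpace ℝ F] (l : F)
    {r : E → ℝ} (hr : ContDiff ℝ ∞ r) : ContDiff ℝ ∞ (fun p => r p • l) :=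
  hr.smul contDiff_const

theorem contDiff_diagForm (a b c : E →L[ℝ] ℝ) {s t : E → ℝ} (hs : ContDiff ℝ ∞ s)
    (ht : ContDiff ℝ ∞ t) : ContDiff ℝ ∞ (fun p => diagForm a b c (s p) (t p)) := by
  exact ((contDiff_smul_left _ hs).add (contDiff_smul_left _ ht)).add contDiff_const

theorem trivialization_bilinForm (x y : E)
    (b : TangentSpace 𝓘(ℝ, E) y →L[ℝ] TangentSpace 𝓘(ℝ, E) y →L[ℝ] ℝ) :
    (trivializationAt (E →L[ℝ] E →L[ℝ] ℝ)
      (fun z : E => TangentSpace 𝓘(ℝ, E) z →L[ℝ] TangentSpace 𝓘(ℝ, E) z →L[ℝ] ℝ) x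
      ⟨y, b⟩).2 = b := by
  rw [hom_trivializationAt_apply]
  dsimp only
  ext v w
  simp only [ContinuousLinearMap.inCoordinates, TangentBundle.symmL_model_space]
  rw [ContinuousLinearMap.comp_apply, Bundle.Trivialization.continuousLinearMapAt_apply,
    Bundle.Trivialization.coe_linearMapAt_of_mem _ (by simp [chartAt_self_eq])]
  simp [hom_trivializationAt_apply, ContinuousLinearMap.inCoordinates]
  rfl

/-- The Riemannian metric on a vector space `E` given by a smooth family `B` of positive
definite symmetric bilinear forms, each tangent space of `E` being identified with `E`. -/
def metricOfForm (B : E → E →L[ℝ] E →L[ℝ] ℝ) (hsymm : ∀ p v w, B p v w = B p w v)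
    (hpos : ∀ p v, v ≠ 0 → 0 < B p v v)
    (hbdd : ∀ p, Bornology.IsVonNBounded ℝ {v : E | B p v v < 1}) (hB : ContDiff ℝ ∞ B) :
    Bundle.ContMDiffRiemannianMetric 𝓘(ℝ, E) ∞ E (fun x : E => TangentSpace 𝓘(ℝ, E) x) where
  inner p := (B p : E →L[ℝ] E →L[ℝ] ℝ)
  symm := hsymm
  pos := hpos
  isVonNBounded := hbdd
  contMDiff := by
    intro x
    refine (Bundle.contMDiffAt_section x).2 ?_
    refine ContMDiffAt.congr_of_eventuallyEq (f := B) hB.contMDiff.contMDiffAt ?_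
    exact Filter.Eventually.of_forall fun y => trivialization_bilinForm x y (B y)

end VectorSpace

section Sol

/-- The linear form `dxⁱ` on `ℝ³`. -/
def dcoord (i : Fin 3) : Coord 3 →L[ℝ] ℝ := EuclideanSpace.proj i

/-- The bilinear form `e^{2z} dx² + e^{-2z} dy² + dz²` at the point `p = (x, y, z)` of `ℝ³`. -/
def solForm (p : Coord 3) : Coord 3 →L[ℝ] Coord 3 →L[ℝ] ℝ :=
  diagForm (dcoord 0) (dcoord 1) (dcoord 2) (Real.exp (2 * p 2)) (Real.exp (-(2 * p 2)))

theorem solForm_apply (p v w : Coord 3) :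
    solForm p v w = Real.exp (2 * p 2) * (v 0 * w 0) + Real.exp (-(2 * p 2)) * (v 1 * w 1)
      + v 2 * w 2 := by
  simp [solForm, diagForm, dcoord]

theorem contDiff_solForm : ContDiff ℝ ∞ solForm := by
  have h2 : ContDiff ℝ ∞ (fun p : Coord 3 => p 2) := (dcoord 2).contDiff
  exact contDiff_diagForm _ _ _ (contDiff_const.mul h2).exp (contDiff_const.mul h2).neg.exp

theorem solForm_symm (p v w : Coord 3) : solForm p v w = solForm p w v := by
  rw [solForm_apply, solForm_apply]
  ring

theorem solForm_pos (p v : Coord 3) (hv : v ≠ 0) : 0 < solForm p v v := by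
  rw [solForm_apply]
  have h0 := mul_nonneg (Real.exp_pos (2 * p 2)).le (mul_self_nonneg (v 0))
  have h1 := mul_nonneg (Real.exp_pos (-(2 * p 2))).le (mul_self_nonneg (v 1))
  have h2 : 0 ≤ v 2 * v 2 := mul_self_nonneg _
  by_contra hneg
  apply hv
  have e0 : Real.exp (2 * p 2) * (v 0 * v 0) = 0 := by linarith
  have e1 : Real.exp (-(2 * p 2)) * (v 1 * v 1) = 0 := by linarith
  have e2 : v 2 * v 2 = 0 := by linarith
  have z0 : v 0 = 0 := by simpa [Real.exp_ne_zero] using e0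
  have z1 : v 1 = 0 := by simpa [Real.exp_ne_zero] using e1
  have z2 : v 2 = 0 := by simpa using e2
  ext i
  fin_cases i <;> simp [z0, z1, z2]

theorem solForm_bounded (p : Coord 3) :
    Bornology.IsVonNBounded ℝ {v : Coord 3 | solForm p v v < 1} := by
  rw [NormedSpace.isVonNBounded_iff, isBounded_iff_forall_norm_le]
  refine ⟨Real.exp (-(2 * p 2)) + Real.exp (2 * p 2) + 1, fun v hv => ?_⟩
  have hv' : solForm p v v < 1 := hv
  rw [solForm_apply] at hv'
  have hab : Real.exp (2 * p 2) * Real.exp (-(2 * p 2)) = 1 := by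
    rw [← Real.exp_add]; simp
  have ha := Real.exp_pos (2 * p 2)
  have hb := Real.exp_pos (-(2 * p 2))
  set a := Real.exp (2 * p 2)
  set b := Real.exp (-(2 * p 2))
  have k0 : 0 ≤ a * (v 0 * v 0) := mul_nonneg ha.le (mul_self_nonneg _)
  have k1 : 0 ≤ b * (v 1 * v 1) := mul_nonneg hb.le (mul_self_nonneg _)
  have k2 : 0 ≤ v 2 * v 2 := mul_self_nonneg _
  have b0 : v 0 * v 0 ≤ b := by
    have : b * (a * (v 0 * v 0)) ≤ b * 1 := by gcongr; linarith
    calc v 0 * v 0 = (a * b) * (v 0 * v 0) := by rw [hab, one_mul]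
      _ = b * (a * (v 0 * v 0)) := by ring
      _ ≤ b := by linarith
  have b1 : v 1 * v 1 ≤ a := by
    have : a * (b * (v 1 * v 1)) ≤ a * 1 := by gcongr; linarith
    calc v 1 * v 1 = (a * b) * (v 1 * v 1) := by rw [hab, one_mul]
      _ = a * (b * (v 1 * v 1)) := by ring
      _ ≤ a := by linarith
  have b2 : v 2 * v 2 ≤ 1 := by linarith
  have hn : ‖v‖ ^ 2 ≤ b + a + 1 := by
    rw [EuclideanSpace.real_norm_sq_eq, Fin.sum_univ_three]
    nlinarith
  nlinarith [norm_nonneg v]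

/-- Sol space: the Riemannian metric `e^{2z} dx² + e^{-2z} dy² + dz²` on `ℝ³`. -/
def solMetric : Metric 3 (Coord 3) :=
  metricOfForm solForm solForm_symm solForm_pos solForm_bounded contDiff_solForm

theorem solMetric_inner (p v w : Coord 3) :
    solMetric.inner p v w = Real.exp (2 * p 2) * (v 0 * w 0)
      + Real.exp (-(2 * p 2)) * (v 1 * w 1) + v 2 * w 2 :=
  solForm_apply p v w

end Sol

end SolSubmersion

end

noncomputable section

namespace SolSubmersion

/-! A harmonic Riemannian submersion from a 3-manifold to a surface has geodesic fibres, which makes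
its unit vertical field `V` Killing; Sol has no unit Killing field, even locally.

Everything is done in one chart of `N`. Let `F` be the map read in that chart, `K` the matrix of
`h`, and `G` the Gram matrix of the Sol gradients of the components of `F`. These gradients span the
horizontal plane, so the submersion property becomes `K(F) * G = 1`
(`metricMatrix_mul_solGramMatrix`). Differentiating this relation along horizontal vectors shows
that `∇dφ` has zero horizontal trace (`sum_christoffel_mul_solGram`), so harmonicity leaves `Hess
Fᵅ(V, V) = 0` (`sum_solHess_unitVertical`). Differentiating it along `V` shows that `G` is constant
along fibres.

With `|V| = 1` and `dF(V) = 0`, this kills the Lie derivative of the metric along `V` on the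
vertical-vertical, mixed and horizontal-horizontal pairs (`lieMetric_eq_zero`). Finally,
differentiating `|V|² = 1` twice in `z` with the Killing equations gives a vanishing sum of squares
that forces `V = 0` (`no_unit_killing`). -/

theorem bilin_sum_smul {E ι : Type*} [NormedAddCommGroup E] [NormedSpace ℝ E] [Fintype ι]
    (B : E →L[ℝ] E →L[ℝ] ℝ) (a b : ι → ℝ) (c : ι → E) :
    B (∑ i, a i • c i) (∑ j, b j • c j) = ∑ i, ∑ j, a i * b j * B (c i) (c j) := by
  simp only [map_sum, sum_apply, map_smul, smul_apply, smul_eq_mul, Finset.mul_sum]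
  rw [Finset.sum_comm]
  refine Finset.sum_congr rfl fun i _ => Finset.sum_congr rfl fun j _ => ?_
  ring

/-! ### Regularity of the metric coefficients in a chart. -/

section Charts

variable {n : ℕ} {M : Type*} [TopologicalSpace M] [ChartedSpace (Coord n) M]
  [IsManifold (𝓡 n) ∞ M]

theorem sum_smul_stdVec (v : Coord n) : ∑ i, v i • (stdVec i : Coord n) = v := by
  ext j
  simp [stdVec, Finset.sum_apply, Pi.single_apply]

theorem stdVec_apply (i j : Fin n) : (stdVec i : Coord n) j = if j = i then 1 else 0 := by
  simp [stdVec]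

theorem inner_congr_point (g : Metric n M) {p q : M} (hpq : p = q) (v w : Coord n) :
    g.inner p (v : TangentSpace (𝓡 n) p) (w : TangentSpace (𝓡 n) p)
      = g.inner q (v : TangentSpace (𝓡 n) q) (w : TangentSpace (𝓡 n) q) := by
  subst hpq
  rfl

theorem contMDiffAt_coordVec {e : OpenPartialHomeomorph M (Coord n)}
    (he : e ∈ atlas (Coord n) M) (i : Fin n) {u : Coord n} (hu : u ∈ e.target) :
    ContMDiffAt 𝓘(ℝ, Coord n) ((𝓡 n).prod 𝓘(ℝ, Coord n)) 1
      (fun v => (⟨e.symm v, coordVec e i v⟩ : TangentBundle (𝓡 n) M)) u := by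
  have hs : ContMDiffOn (𝓡 n) (𝓡 n) ∞ e.symm e.target :=
    contMDiffOn_symm_of_mem_maximalAtlas (IsManifold.subset_maximalAtlas he)
  -- The coordinate field is the tangent map of `e.symm` applied to a constant section; one
  -- derivative is lost, and class `C¹` is enough for Christoffel symbols.
  have ht := hs.contMDiffOn_tangentMapWithin (m := 1) (by norm_cast)
    e.open_target.uniqueMDiffOn
  have hc : ContMDiff 𝓘(ℝ, Coord n) ((𝓡 n).prod 𝓘(ℝ, Coord n)) 1
      (fun v : Coord n => (⟨v, (stdVec i : Coord n)⟩ : TangentBundle (𝓡 n) (Coord n))) := by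
    intro v
    refine (Bundle.contMDiffAt_section (IB := 𝓘(ℝ, Coord n)) (F := Coord n)
      (E := fun x : Coord n => TangentSpace 𝓘(ℝ, Coord n) x)
      (s := fun _ => (stdVec i : Coord n)) v).2 ?_
    simpa [TangentBundle.trivializationAt_apply] using contMDiffAt_const
  have hcomp := ht.comp (s := e.target) hc.contMDiffOn (fun v hv => hv)
  refine ((hcomp u hu).contMDiffAt (e.open_target.mem_nhds hu)).congr_of_eventuallyEq ?_
  filter_upwards [e.open_target.mem_nhds hu] with v hv
  simp only [Function.comp, tangentMapWithin, coordVec]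
  rw [mfderivWithin_of_isOpen e.open_target hv]

theorem differentiableAt_metricMatrix (g : Metric n M) {e : OpenPartialHomeomorph M (Coord n)}
    (he : e ∈ atlas (Coord n) M) {u : Coord n} (hu : u ∈ e.target) (i j : Fin n) :
    DifferentiableAt ℝ (fun v => metricMatrix g e v i j) u := by
  have hs : ContMDiffAt (𝓡 n) (𝓡 n) ∞ e.symm u :=
    (contMDiffOn_symm_of_mem_maximalAtlas (IsManifold.subset_maximalAtlas he)).contMDiffAt
      (e.open_target.mem_nhds hu)
  have hb : ContMDiffAt 𝓘(ℝ, Coord n) ((𝓡 n).prod 𝓘(ℝ, ℝ)) 1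
      (fun v => Bundle.TotalSpace.mk' ℝ (E := Bundle.Trivial M ℝ) (e.symm v)
        (g.inner (e.symm v) (coordVec e i v) (coordVec e j v))) u := by
    apply ContMDiffAt.clm_bundle_apply₂ (F₁ := Coord n) (F₂ := Coord n)
    · exact ((g.contMDiff.contMDiffAt).of_le (by norm_cast)).comp u (hs.of_le (by norm_cast))
    · exact contMDiffAt_coordVec he i hu
    · exact contMDiffAt_coordVec he j hu
  simp only [Bundle.contMDiffAt_totalSpace] at hb
  exact hb.2.contDiffAt.differentiableAt one_ne_zero

theorem metricMatrix_symm (g : Metric n M) (e : OpenPartialHomeomorph M (Coord n))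
    (u : Coord n) (i j : Fin n) : metricMatrix g e u i j = metricMatrix g e u j i :=
  g.symm _ _ _

end Charts

/-! ### Maps into `N` read in a chart. -/

section Reps

variable {m n : ℕ} {N : Type*} [TopologicalSpace N] [ChartedSpace (Coord n) N]
  [IsManifold (𝓡 n) ∞ N] {φ : Coord m → N} {e' : OpenPartialHomeomorph N (Coord n)}

theorem contDiffAt_chart_comp (he' : e' ∈ atlas (Coord n) N) (hφ : ContMDiff (𝓡 m) (𝓡 n) ∞ φ)
    {p : Coord m} (hp : φ p ∈ e'.source) : ContDiffAt ℝ ∞ (fun v => e' (φ v)) p := by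
  have h1 : ContMDiffAt (𝓡 n) (𝓡 n) ∞ e' (φ p) :=
    (contMDiffOn_of_mem_maximalAtlas (IsManifold.subset_maximalAtlas he')).contMDiffAt
      (e'.open_source.mem_nhds hp)
  exact (h1.comp p (hφ p)).contDiffAt

theorem mfderiv_eq_sum_coordVec (he' : e' ∈ atlas (Coord n) N)
    (hφ : ContMDiff (𝓡 m) (𝓡 n) ∞ φ) {p : Coord m} (hp : φ p ∈ e'.source) (X : Coord m) :
    (mfderiv (𝓡 m) (𝓡 n) φ p X : Coord n)
      = ∑ α, (fderiv ℝ (fun v => e' (φ v)) p X) α • (coordVec e' α (e' (φ p)) : Coord n) := by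
  have hF := contDiffAt_chart_comp he' hφ hp
  have hs : ContMDiffAt (𝓡 n) (𝓡 n) ∞ e'.symm (e' (φ p)) :=
    (contMDiffOn_symm_of_mem_maximalAtlas (IsManifold.subset_maximalAtlas he')).contMDiffAt
      (e'.open_target.mem_nhds (e'.map_source hp))
  have hev : φ =ᶠ[nhds p] (e'.symm ∘ fun v => e' (φ v)) := by
    filter_upwards [(hφ.continuous.isOpen_preimage _ e'.open_source).mem_nhds hp] with v hv
    exact (e'.left_inv hv).symm
  have hcomp := mfderiv_comp (I := 𝓡 m) (I' := 𝓡 n) (I'' := 𝓡 n) p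
    (hs.mdifferentiableAt (by simp)) (hF.contMDiffAt.mdifferentiableAt (by simp))
  rw [hev.mfderiv_eq, hcomp, mfderiv_eq_fderiv]
  set w : Coord n := fderiv ℝ (fun v => e' (φ v)) p X with hw
  change (mfderiv (𝓡 n) (𝓡 n) e'.symm (e' (φ p)) w : Coord n) = _
  conv_lhs => rw [← sum_smul_stdVec w]
  exact (map_sum _ _ _).trans (Finset.sum_congr rfl fun α _ => map_smul _ _ _)

theorem inner_mfderiv (h : Metric n N) (he' : e' ∈ atlas (Coord n) N)
    (hφ : ContMDiff (𝓡 m) (𝓡 n) ∞ φ) {p : Coord m} (hp : φ p ∈ e'.source) (X Y : Coord m) :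
    h.inner (φ p) (mfderiv (𝓡 m) (𝓡 n) φ p X) (mfderiv (𝓡 m) (𝓡 n) φ p Y)
      = ∑ α, ∑ β, (fderiv ℝ (fun v => e' (φ v)) p X) α * (fderiv ℝ (fun v => e' (φ v)) p Y) β
          * metricMatrix h e' (e' (φ p)) α β := by
  have hX := mfderiv_eq_sum_coordVec he' hφ hp X
  have hY := mfderiv_eq_sum_coordVec he' hφ hp Y
  -- The matrix of `h` lives at `e'.symm (e' (φ p))`, which equals `φ p` only propositionally, so
  -- the inner product has to be transported.
  have key := inner_congr_point h (e'.left_inv hp).symm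
    (mfderiv (𝓡 m) (𝓡 n) φ p X) (mfderiv (𝓡 m) (𝓡 n) φ p Y)
  refine key.trans ?_
  rw [hX, hY]
  set B : Coord n →L[ℝ] Coord n →L[ℝ] ℝ := h.inner (e'.symm (e' (φ p))) with hB
  set c : Fin n → Coord n := fun α => coordVec e' α (e' (φ p)) with hc
  change B (∑ α, (fderiv ℝ (fun v => e' (φ v)) p X) α • c α)
    (∑ α, (fderiv ℝ (fun v => e' (φ v)) p Y) α • c α) = _
  exact bilin_sum_smul B _ _ c

end Reps

/-! ### Gradients, Hessians and Christoffel symbols of Sol. -/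

theorem exp_mul_exp_neg (t : ℝ) : Real.exp t * Real.exp (-t) = 1 := by
  rw [← Real.exp_add, add_neg_cancel, Real.exp_zero]

theorem fderiv_eq_sum_pderiv {n : ℕ} (a : Coord n → ℝ) (p X : Coord n) :
    fderiv ℝ a p X = ∑ i, X i * pderiv i a p := by
  conv_lhs => rw [← sum_smul_stdVec X]
  simp [map_sum, pderiv]

/-- The Sol gradient of a function. -/
def solGrad (a : Coord 3 → ℝ) (p : Coord 3) : Coord 3 :=
  !₂[Real.exp (-(2 * p 2)) * pderiv 0 a p, Real.exp (2 * p 2) * pderiv 1 a p, pderiv 2 a p]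

/-- The inner product of the Sol gradients of two functions. -/
def solGram (a b : Coord 3 → ℝ) (p : Coord 3) : ℝ :=
  Real.exp (-(2 * p 2)) * (pderiv 0 a p * pderiv 0 b p)
    + Real.exp (2 * p 2) * (pderiv 1 a p * pderiv 1 b p) + pderiv 2 a p * pderiv 2 b p

/-- The matrix of the Levi-Civita Hessian of a function on Sol space. -/
def solHess (a : Coord 3 → ℝ) (p : Coord 3) : Matrix (Fin 3) (Fin 3) ℝ :=
  !![pderiv 0 (pderiv 0 a) p + Real.exp (2 * p 2) * pderiv 2 a p, pderiv 0 (pderiv 1 a) p,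
      pderiv 0 (pderiv 2 a) p - pderiv 0 a p;
    pderiv 1 (pderiv 0 a) p, pderiv 1 (pderiv 1 a) p - Real.exp (-(2 * p 2)) * pderiv 2 a p,
      pderiv 1 (pderiv 2 a) p + pderiv 1 a p;
    pderiv 2 (pderiv 0 a) p - pderiv 0 a p, pderiv 2 (pderiv 1 a) p + pderiv 1 a p,
      pderiv 2 (pderiv 2 a) p]

theorem fderiv_solGrad (a b : Coord 3 → ℝ) (p : Coord 3) :
    fderiv ℝ a p (solGrad b p) = solGram a b p := by
  rw [fderiv_eq_sum_pderiv, Fin.sum_univ_three]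
  simp [solGrad, solGram]
  ring

theorem solGram_comm (a b : Coord 3 → ℝ) (p : Coord 3) : solGram a b p = solGram b a p := by
  simp only [solGram]
  ring

theorem solMetric_solGrad (a : Coord 3 → ℝ) (p V : Coord 3) :
    solMetric.inner p (solGrad a p) V = fderiv ℝ a p V := by
  rw [fderiv_eq_sum_pderiv, Fin.sum_univ_three]
  refine (solMetric_inner p (solGrad a p) V).trans ?_
  simp [solGrad]
  linear_combination (V 0 * pderiv 0 a p + V 1 * pderiv 1 a p) * exp_mul_exp_neg (2 * p 2)

section Christoffel

theorem metricMatrix_sol (u : Coord 3) :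
    metricMatrix solMetric (OpenPartialHomeomorph.refl (Coord 3)) u
      = Matrix.diagonal ![Real.exp (2 * u 2), Real.exp (-(2 * u 2)), 1] := by
  have hc : ∀ i, coordVec (M := Coord 3) (OpenPartialHomeomorph.refl (Coord 3)) i u
      = (stdVec i : Coord 3) := by
    intro i
    have : mfderiv (𝓡 3) (𝓡 3) (id : Coord 3 → Coord 3) u
        = ContinuousLinearMap.id ℝ (TangentSpace (𝓡 3) u) := mfderiv_id
    change mfderiv (𝓡 3) (𝓡 3) (id : Coord 3 → Coord 3) u (stdVec i : Coord 3) = _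
    rw [this]
    rfl
  ext i j
  simp only [metricMatrix, Matrix.of_apply]
  rw [hc i, hc j]
  refine (solMetric_inner u (stdVec i : Coord 3) (stdVec j : Coord 3)).trans ?_
  simp only [stdVec_apply]
  fin_cases i <;> fin_cases j <;> simp

theorem metricMatrix_sol_inv (u : Coord 3) :
    (metricMatrix solMetric (OpenPartialHomeomorph.refl (Coord 3)) u)⁻¹
      = Matrix.diagonal ![Real.exp (-(2 * u 2)), Real.exp (2 * u 2), 1] := by
  refine Matrix.inv_eq_right_inv ?_
  rw [metricMatrix_sol, Matrix.diagonal_mul_diagonal, ← Matrix.diagonal_one]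
  congr 1
  ext i
  have := exp_mul_exp_neg (2 * u 2)
  fin_cases i
  · simpa using this
  · simpa [mul_comm] using this
  · simp

theorem hasFDerivAt_exp_coord (c : ℝ) (u : Coord 3) :
    HasFDerivAt (fun v : Coord 3 => Real.exp (c * v 2)) ((Real.exp (c * u 2) * c) • dcoord 2) u := by
  have h2 : HasFDerivAt (fun v : Coord 3 => c * v 2) (c • dcoord 2) u :=
    ((dcoord 2).hasFDerivAt).const_mul c
  simpa [smul_smul] using h2.exp

theorem pderiv_exp_coord (c : ℝ) (u : Coord 3) (i : Fin 3) :
    pderiv i (fun v : Coord 3 => Real.exp (c * v 2)) u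
      = if i = 2 then c * Real.exp (c * u 2) else 0 := by
  simp only [pderiv]
  rw [(hasFDerivAt_exp_coord c u).fderiv]
  change Real.exp (c * u 2) * c * (stdVec i : Coord 3) 2 = _
  rw [stdVec_apply]
  split_ifs <;> simp_all [mul_comm]

theorem pderiv_const {n : ℕ} (c : ℝ) (u : Coord n) (i : Fin n) :
    pderiv i (fun _ : Coord n => c) u = 0 := by
  simp [pderiv]

theorem pderiv_metricMatrix_sol (u : Coord 3) (k i j : Fin 3) :
    pderiv k (fun v => metricMatrix solMetric (OpenPartialHomeomorph.refl (Coord 3)) v i j) u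
      = if k = 2 then
          Matrix.diagonal ![2 * Real.exp (2 * u 2), -2 * Real.exp (-(2 * u 2)), 0] i j
        else 0 := by
  simp only [metricMatrix_sol]
  have e1 := pderiv_exp_coord 2 u
  have e2 := pderiv_exp_coord (-2) u
  simp only [neg_mul] at e2
  fin_cases i <;> fin_cases j <;> simp [pderiv_const, e1, e2]

theorem christoffel_sol (u : Coord 3) (k i j : Fin 3) :
    christoffel solMetric (OpenPartialHomeomorph.refl (Coord 3)) k i j u
      = (1 / 2 : ℝ) * ((![Real.exp (-(2 * u 2)), Real.exp (2 * u 2), 1] : Fin 3 → ℝ) k *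
        ((if i = 2 then
          Matrix.diagonal ![2 * Real.exp (2 * u 2), -2 * Real.exp (-(2 * u 2)), 0] j k else 0)
        + (if j = 2 then
          Matrix.diagonal ![2 * Real.exp (2 * u 2), -2 * Real.exp (-(2 * u 2)), 0] i k else 0)
        - (if k = 2 then
          Matrix.diagonal ![2 * Real.exp (2 * u 2), -2 * Real.exp (-(2 * u 2)), 0] i j else 0))) := by
  simp only [christoffel, pderiv_metricMatrix_sol, metricMatrix_sol_inv]
  rw [Finset.sum_eq_single k]
  · simp
  · intro l _ hl
    rw [Matrix.diagonal_apply_ne _ hl.symm, zero_mul]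
  · simp

end Christoffel

/-! ### The submersion condition as a matrix identity. -/

section Submersion

variable {N : Type*} [TopologicalSpace N] [ChartedSpace (Coord 2) N] [IsManifold (𝓡 2) ∞ N]
  {φ : Coord 3 → N} {e' : OpenPartialHomeomorph N (Coord 2)}

theorem fderiv_component {m n : ℕ} {F : Coord m → Coord n} {p : Coord m}
    (hF : DifferentiableAt ℝ F p) (X : Coord m) (α : Fin n) :
    fderiv ℝ F p X α = fderiv ℝ (fun v => F v α) p X := by
  have h1 := ((EuclideanSpace.proj α : Coord n →L[ℝ] ℝ).hasFDerivAt.comp p hF.hasFDerivAt).fderiv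
  change _ = fderiv ℝ ((EuclideanSpace.proj α : Coord n →L[ℝ] ℝ) ∘ F) p X
  rw [h1]
  rfl

theorem tension_sol (h : Metric 2 N) (α : Fin 2) (p : Coord 3) :
    tension solMetric h φ (OpenPartialHomeomorph.refl (Coord 3)) e' α p
      = (Real.exp (-(2 * p 2)) * solHess (fun v => e' (φ v) α) p 0 0
          + Real.exp (2 * p 2) * solHess (fun v => e' (φ v) α) p 1 1
          + solHess (fun v => e' (φ v) α) p 2 2)
        + ∑ β, ∑ γ, christoffel h e' α β γ (e' (φ p))
            * solGram (fun v => e' (φ v) β) (fun v => e' (φ v) γ) p := by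
  have hloc : ∀ α, localRep φ (OpenPartialHomeomorph.refl (Coord 3)) e' α
      = fun v => e' (φ v) α := fun α => rfl
  have hpd : ∀ (i j : Fin 3) (α), pderiv i (fun v => pderiv j (fun v => e' (φ v) α) v) p
      = pderiv i (pderiv j (fun v => e' (φ v) α)) p := fun i j α => rfl
  simp only [tension, metricMatrix_sol_inv, secondFundForm, christoffel_sol, hloc, hpd,
    OpenPartialHomeomorph.refl_symm, OpenPartialHomeomorph.refl_apply, Fin.sum_univ_three,
    Fin.sum_univ_two, solHess, solGram]
  simp
  ring

/-- The Gram matrix of the components of the map `F` in the Sol cometric. -/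
def solGramMatrix (F : Coord 3 → Coord 2) (p : Coord 3) : Matrix (Fin 2) (Fin 2) ℝ :=
  Matrix.of fun α β => solGram (fun v => F v α) (fun v => F v β) p

/-- The cross product of the gradients of the two components of `F`. -/
def solCross (F : Coord 3 → Coord 2) (p : Coord 3) : Fin 3 → ℝ :=
  ![pderiv 1 (fun v => F v 0) p * pderiv 2 (fun v => F v 1) p
      - pderiv 2 (fun v => F v 0) p * pderiv 1 (fun v => F v 1) p,
    pderiv 2 (fun v => F v 0) p * pderiv 0 (fun v => F v 1) p
      - pderiv 0 (fun v => F v 0) p * pderiv 2 (fun v => F v 1) p,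
    pderiv 0 (fun v => F v 0) p * pderiv 1 (fun v => F v 1) p
      - pderiv 1 (fun v => F v 0) p * pderiv 0 (fun v => F v 1) p]

/-- Lagrange's identity. Sol has volume density 1, so the cross product of the two differentials,
read as a vector, has Sol length squared equal to the Gram determinant. -/
theorem det_solGramMatrix (F : Coord 3 → Coord 2) (p : Coord 3) :
    (solGramMatrix F p).det = Real.exp (2 * p 2) * solCross F p 0 ^ 2
      + Real.exp (-(2 * p 2)) * solCross F p 1 ^ 2 + solCross F p 2 ^ 2 := by
  rw [Matrix.det_fin_two]
  simp only [solGramMatrix, Matrix.of_apply, solGram, solCross]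
  simp
  linear_combination (pderiv 0 (fun v => F v 0) p * pderiv 1 (fun v => F v 1) p
      - pderiv 1 (fun v => F v 0) p * pderiv 0 (fun v => F v 1) p) ^ 2
    * exp_mul_exp_neg (2 * p 2)

theorem det_solGramMatrix_pos {F : Coord 3 → Coord 2} {p : Coord 3}
    (hF : DifferentiableAt ℝ F p) (hs : Function.Surjective (fderiv ℝ F p)) :
    0 < (solGramMatrix F p).det := by
  obtain ⟨X, hX⟩ := hs (stdVec 0)
  obtain ⟨Y, hY⟩ := hs (stdVec 1)
  have hval : ∀ (Z : Coord 3) (α : Fin 2), fderiv ℝ F p Z α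
      = Z 0 * pderiv 0 (fun v => F v α) p + Z 1 * pderiv 1 (fun v => F v α) p
        + Z 2 * pderiv 2 (fun v => F v α) p := by
    intro Z α
    rw [fderiv_component hF, fderiv_eq_sum_pderiv, Fin.sum_univ_three]
  have x0 := hval X 0
  have x1 := hval X 1
  have y0 := hval Y 0
  have y1 := hval Y 1
  rw [hX, stdVec_apply] at x0 x1
  rw [hY, stdVec_apply] at y0 y1
  norm_num at x0 x1 y0 y1
  have hne : ¬ (solCross F p 0 = 0 ∧ solCross F p 1 = 0 ∧ solCross F p 2 = 0) := by
    rintro ⟨h0, h1, h2⟩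
    simp only [solCross, Matrix.cons_val] at h0 h1 h2
    set a0 := pderiv 0 (fun v => F v 0) p
    set a1 := pderiv 1 (fun v => F v 0) p
    set a2 := pderiv 2 (fun v => F v 0) p
    set b0 := pderiv 0 (fun v => F v 1) p
    set b1 := pderiv 1 (fun v => F v 1) p
    set b2 := pderiv 2 (fun v => F v 1) p
    -- Binet–Cauchy: the left side is the dot product of `X × Y` with `solCross`. It equals 1
    -- because `X` and `Y` are preimages of the standard basis.
    have key : (X 0 * a0 + X 1 * a1 + X 2 * a2) * (Y 0 * b0 + Y 1 * b1 + Y 2 * b2)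
        - (X 0 * b0 + X 1 * b1 + X 2 * b2) * (Y 0 * a0 + Y 1 * a1 + Y 2 * a2) = 0 := by
      linear_combination (X 1 * Y 2 - X 2 * Y 1) * h0 + (X 2 * Y 0 - X 0 * Y 2) * h1
        + (X 0 * Y 1 - X 1 * Y 0) * h2
    rw [← x0, ← x1, ← y0, ← y1] at key
    norm_num at key
  rw [det_solGramMatrix]
  have hE := Real.exp_pos (2 * p 2)
  have hE' := Real.exp_pos (-(2 * p 2))
  by_cases h0 : solCross F p 0 = 0
  · by_cases h1 : solCross F p 1 = 0
    · have h2 : solCross F p 2 ≠ 0 := fun h2 => hne ⟨h0, h1, h2⟩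
      positivity
    · positivity
  · positivity

theorem surjective_fderiv_chart_comp (he' : e' ∈ atlas (Coord 2) N)
    (hφ : ContMDiff (𝓡 3) (𝓡 2) ∞ φ) {p : Coord 3} (hp : φ p ∈ e'.source)
    (hs : Function.Surjective (mfderiv (𝓡 3) (𝓡 2) φ p)) :
    Function.Surjective (fderiv ℝ (fun v => e' (φ v)) p) := by
  have he := mdifferentiable_of_mem_atlas (I := 𝓡 2) he'
  have hcomp := mfderiv_comp (I := 𝓡 3) (I' := 𝓡 2) (I'' := 𝓡 2) p
    (he.mdifferentiableAt hp) ((hφ p).mdifferentiableAt (by simp))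
  rw [← mfderiv_eq_fderiv]
  change Function.Surjective (mfderiv (𝓡 3) (𝓡 2) (e' ∘ φ) p)
  rw [hcomp]
  exact (he.mfderiv_surjective hp).comp hs

theorem ker_mfderiv_chart_comp (he' : e' ∈ atlas (Coord 2) N)
    (hφ : ContMDiff (𝓡 3) (𝓡 2) ∞ φ) {p : Coord 3} (hp : φ p ∈ e'.source) (V : Coord 3)
    (hV : mfderiv (𝓡 3) (𝓡 2) φ p V = 0) : fderiv ℝ (fun v => e' (φ v)) p V = 0 := by
  have he := mdifferentiable_of_mem_atlas (I := 𝓡 2) he'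
  have hcomp := mfderiv_comp (I := 𝓡 3) (I' := 𝓡 2) (I'' := 𝓡 2) p
    (he.mdifferentiableAt hp) ((hφ p).mdifferentiableAt (by simp))
  rw [← mfderiv_eq_fderiv]
  change mfderiv (𝓡 3) (𝓡 2) (e' ∘ φ) p V = 0
  rw [hcomp]
  exact (congrArg (mfderiv (𝓡 2) (𝓡 2) e' (φ p)) hV).trans (map_zero _)

/-- Gradients of the components are horizontal, and `dF` sends them to the columns of `G`. Isometry
on them reads `G * K * G = G`, and `G` is invertible because `F` is a submersion. -/
theorem metricMatrix_mul_solGramMatrix {h : Metric 2 N} (he' : e' ∈ atlas (Coord 2) N)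
    (hφ : IsRiemannianSubmersion solMetric h φ) {p : Coord 3} (hp : φ p ∈ e'.source) :
    metricMatrix h e' (e' (φ p)) * solGramMatrix (fun v => e' (φ v)) p = 1 := by
  set F : Coord 3 → Coord 2 := fun v => e' (φ v) with hFdef
  set G := solGramMatrix F p with hG
  set K := metricMatrix h e' (e' (φ p)) with hK
  have hF : DifferentiableAt ℝ F p :=
    (contDiffAt_chart_comp he' hφ.smooth hp).differentiableAt (by simp)
  have hdet : 0 < G.det := det_solGramMatrix_pos hF
    (surjective_fderiv_chart_comp he' hφ.smooth hp (hφ.surjective_mfderiv p))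
  have hhor : ∀ α : Fin 2, IsHorizontal (n := 2) solMetric φ p (solGrad (fun v => F v α) p) := by
    intro α V hV
    have h0 : fderiv ℝ F p V = 0 := ker_mfderiv_chart_comp he' hφ.smooth hp V hV
    refine (solMetric_solGrad _ p V).trans ?_
    exact (fderiv_component hF V α).symm.trans (congrArg (fun w : Coord 2 => w α) h0)
  have hGKG : G * K * G = G := by
    ext γ δ
    have hiso := hφ.isometry_horizontal p _ _ (hhor γ) (hhor δ)
    rw [inner_mfderiv h he' hφ.smooth hp] at hiso
    have hr : solMetric.inner p (solGrad (fun v => F v γ) p) (solGrad (fun v => F v δ) p)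
        = solGram (fun v => F v γ) (fun v => F v δ) p :=
      (solMetric_solGrad _ p _).trans (fderiv_solGrad _ _ p)
    have hl : ∀ α β : Fin 2, fderiv ℝ F p (solGrad (fun v => F v β) p) α
        = solGram (fun v => F v α) (fun v => F v β) p := by
      intro α β
      rw [fderiv_component hF, fderiv_solGrad]
    have hiso' := hiso.trans hr
    simp only [← hFdef, hl] at hiso'
    rw [hG]
    simp only [Matrix.mul_apply, Fin.sum_univ_two, solGramMatrix, Matrix.of_apply] at hiso' ⊢
    rw [← hiso', solGram_comm (fun v => F v γ) (fun v => F v 0),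
      solGram_comm (fun v => F v γ) (fun v => F v 1)]
    ring
  have hu : IsUnit G.det := isUnit_iff_ne_zero.2 hdet.ne'
  have h1 : G⁻¹ * (G * K * G) = G⁻¹ * G := by rw [hGKG]
  rwa [Matrix.mul_assoc, Matrix.nonsing_inv_mul_cancel_left _ _ hu,
    Matrix.nonsing_inv_mul _ hu] at h1

end Submersion

/-! ### Partial derivatives and metric compatibility of the Sol Hessian. -/

section PartialDerivatives

variable {n : ℕ} {a b : Coord n → ℝ} {p : Coord n}

theorem contDiffAt_pderiv (ha : ContDiffAt ℝ ∞ a p) (i : Fin n) :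
    ContDiffAt ℝ ∞ (pderiv i a) p :=
  (ha.fderiv_right (m := ∞) (by simp)).clm_apply contDiffAt_const

theorem pderiv_comm (ha : ContDiffAt ℝ ∞ a p) (i j : Fin n) :
    pderiv i (pderiv j a) p = pderiv j (pderiv i a) p := by
  have hd : DifferentiableAt ℝ (fderiv ℝ a) p :=
    (ha.fderiv_right (m := ∞) (by simp)).differentiableAt (by simp)
  have hs : ∀ i j : Fin n, pderiv i (pderiv j a) p
      = fderiv ℝ (fderiv ℝ a) p (stdVec i) (stdVec j) := by
    intro i j
    have := (hd.hasFDerivAt.clm_apply (hasFDerivAt_const (stdVec j : Coord n) p)).fderiv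
    change fderiv ℝ (fun y => fderiv ℝ a y (stdVec j)) p (stdVec i) = _
    rw [this]
    simp
  rw [hs, hs]
  exact (ha.isSymmSndFDerivAt (by simpa using (by norm_cast : (2 : WithTop ℕ∞) ≤ ∞))).eq _ _

theorem pderiv_add (ha : DifferentiableAt ℝ a p) (hb : DifferentiableAt ℝ b p) (i : Fin n) :
    pderiv i (fun v => a v + b v) p = pderiv i a p + pderiv i b p := by
  simp only [pderiv, fderiv_fun_add ha hb, add_apply]

theorem pderiv_mul (ha : DifferentiableAt ℝ a p) (hb : DifferentiableAt ℝ b p) (i : Fin n) :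
    pderiv i (fun v => a v * b v) p = pderiv i a p * b p + a p * pderiv i b p := by
  simp only [pderiv, fderiv_fun_mul ha hb, add_apply, smul_apply, smul_eq_mul]
  ring

theorem pderiv_congr (hab : a =ᶠ[nhds p] b) (i : Fin n) : pderiv i a p = pderiv i b p := by
  simp only [pderiv, hab.fderiv_eq]

end PartialDerivatives

theorem pderiv_expPos (u : Coord 3) (i : Fin 3) :
    pderiv i (fun v : Coord 3 => Real.exp (2 * v 2)) u
      = if i = 2 then 2 * Real.exp (2 * u 2) else 0 :=
  pderiv_exp_coord 2 u i

theorem pderiv_expNeg (u : Coord 3) (i : Fin 3) :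
    pderiv i (fun v : Coord 3 => Real.exp (-(2 * v 2))) u
      = if i = 2 then -2 * Real.exp (-(2 * u 2)) else 0 := by
  have := pderiv_exp_coord (-2) u i
  simpa only [neg_mul] using this

theorem differentiableAt_expPos (u : Coord 3) :
    DifferentiableAt ℝ (fun v : Coord 3 => Real.exp (2 * v 2)) u :=
  (hasFDerivAt_exp_coord 2 u).differentiableAt

theorem differentiableAt_expNeg (u : Coord 3) :
    DifferentiableAt ℝ (fun v : Coord 3 => Real.exp (-(2 * v 2))) u := by
  simpa only [neg_mul] using (hasFDerivAt_exp_coord (-2) u).differentiableAt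

theorem contDiffAt_solGram {a b : Coord 3 → ℝ} {p : Coord 3} (ha : ContDiffAt ℝ ∞ a p)
    (hb : ContDiffAt ℝ ∞ b p) : ContDiffAt ℝ ∞ (solGram a b) p := by
  have h2 : ContDiff ℝ ∞ (fun p : Coord 3 => p 2) := (dcoord 2).contDiff
  have hE : ContDiffAt ℝ ∞ (fun v : Coord 3 => Real.exp (2 * v 2)) p :=
    (contDiff_const.mul h2).exp.contDiffAt
  have hE' : ContDiffAt ℝ ∞ (fun v : Coord 3 => Real.exp (-(2 * v 2))) p :=
    (contDiff_const.mul h2).neg.exp.contDiffAt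
  exact ((hE'.mul ((contDiffAt_pderiv ha 0).mul (contDiffAt_pderiv hb 0))).add
    (hE.mul ((contDiffAt_pderiv ha 1).mul (contDiffAt_pderiv hb 1)))).add
    ((contDiffAt_pderiv ha 2).mul (contDiffAt_pderiv hb 2))

theorem solHess_symm {a : Coord 3 → ℝ} {p : Coord 3} (ha : ContDiffAt ℝ ∞ a p) (i j : Fin 3) :
    solHess a p i j = solHess a p j i := by
  have h01 := pderiv_comm ha 0 1
  have h02 := pderiv_comm ha 0 2
  have h12 := pderiv_comm ha 1 2
  fin_cases i <;> fin_cases j <;> simp [solHess, h01, h02, h12]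

/-- Compatibility of the Levi-Civita connection with the metric: `d⟨∇a, ∇b⟩ = Hess a(·, ∇b) + Hess
b(·, ∇a)`. -/
theorem pderiv_solGram {a b : Coord 3 → ℝ} {p : Coord 3} (ha : ContDiffAt ℝ ∞ a p)
    (hb : ContDiffAt ℝ ∞ b p) (k : Fin 3) :
    pderiv k (solGram a b) p
      = ∑ j, (solHess a p k j * solGrad b p j + solHess b p k j * solGrad a p j) := by
  have da : ∀ i, DifferentiableAt ℝ (pderiv i a) p :=
    fun i => (contDiffAt_pderiv ha i).differentiableAt (by simp)
  have db : ∀ i, DifferentiableAt ℝ (pderiv i b) p :=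
    fun i => (contDiffAt_pderiv hb i).differentiableAt (by simp)
  have dab : ∀ i, DifferentiableAt ℝ (fun v => pderiv i a v * pderiv i b v) p :=
    fun i => (da i).fun_mul (db i)
  have d0 := (differentiableAt_expNeg p).fun_mul (dab 0)
  have d1 := (differentiableAt_expPos p).fun_mul (dab 1)
  have hexp := exp_mul_exp_neg (2 * p 2)
  change pderiv k (fun v => Real.exp (-(2 * v 2)) * (pderiv 0 a v * pderiv 0 b v)
    + Real.exp (2 * v 2) * (pderiv 1 a v * pderiv 1 b v) + pderiv 2 a v * pderiv 2 b v) p = _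
  rw [pderiv_add (d0.fun_add d1) (dab 2), pderiv_add d0 d1,
    pderiv_mul (differentiableAt_expNeg p) (dab 0), pderiv_mul (differentiableAt_expPos p) (dab 1),
    pderiv_mul (da 0) (db 0), pderiv_mul (da 1) (db 1), pderiv_mul (da 2) (db 2),
    pderiv_expNeg, pderiv_expPos, Fin.sum_univ_three]
  fin_cases k
  · simp [solHess, solGrad]
    linear_combination (-pderiv 2 a p * pderiv 0 b p - pderiv 2 b p * pderiv 0 a p) * hexp
  · simp [solHess, solGrad]
    linear_combination (pderiv 2 a p * pderiv 1 b p + pderiv 2 b p * pderiv 1 a p) * hexp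
  · simp [solHess, solGrad]
    ring

/-- The value of the Sol Hessian on two vectors. -/
def solHessForm (a : Coord 3 → ℝ) (p X Y : Coord 3) : ℝ :=
  ∑ i, ∑ j, solHess a p i j * X i * Y j

theorem solHessForm_symm {a : Coord 3 → ℝ} {p : Coord 3} (ha : ContDiffAt ℝ ∞ a p)
    (X Y : Coord 3) : solHessForm a p X Y = solHessForm a p Y X := by
  simp only [solHessForm]
  rw [Finset.sum_comm]
  refine Finset.sum_congr rfl fun i _ => Finset.sum_congr rfl fun j _ => ?_
  rw [solHess_symm ha]
  ring

theorem fderiv_solGram {a b : Coord 3 → ℝ} {p : Coord 3} (ha : ContDiffAt ℝ ∞ a p)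
    (hb : ContDiffAt ℝ ∞ b p) (X : Coord 3) :
    fderiv ℝ (solGram a b) p X
      = solHessForm a p X (solGrad b p) + solHessForm b p X (solGrad a p) := by
  rw [fderiv_eq_sum_pderiv]
  simp only [pderiv_solGram ha hb, solHessForm, ← Finset.sum_add_distrib, Finset.mul_sum]
  refine Finset.sum_congr rfl fun i _ => Finset.sum_congr rfl fun j _ => ?_
  ring

/-! ### Derivatives of `K(F) * G = 1` and the horizontal trace. -/

/-- Contraction of the Christoffel symbols of a metric `K` with its inverse `G`, when the
horizontal derivatives of `G` are given by symmetric forms `T`. -/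
theorem christoffel_contraction {K G : Matrix (Fin 2) (Fin 2) ℝ} {dK T : Fin 2 → Fin 2 → Fin 2 → ℝ}
    (hK : ∀ i j, K i j = K j i) (hG : ∀ i j, G i j = G j i)
    (hdK : ∀ l i j, dK l i j = dK l j i) (hT : ∀ l i j, T l i j = T l j i)
    (hD : ∀ γ β δ, ∑ s, ((∑ l, dK l β s * G l γ) * G s δ + K β s * (T s γ δ + T δ γ s)) = 0)
    (α : Fin 2) :
    ∑ β, ∑ γ, ((1 / 2 : ℝ) * ∑ l, G α l * (dK β γ l + dK γ β l - dK l β γ)) * G β γ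
      = -∑ β, ∑ γ, K β γ * T α β γ := by
  simp only [Fin.sum_univ_two] at hD ⊢
  have hK1 := hK 1 0
  have hG1 := hG 1 0
  have hdK1 := fun l => hdK l 1 0
  have hT1 := fun l => hT l 1 0
  simp only [Fin.forall_fin_two, hK1, hG1, hdK1, hT1] at hD
  -- The combination mirrors the Christoffel symbol: `hD` summed over `γ = β` with `δ = α` gives the
  -- first two terms, and half of `hD` summed over `β = δ` with `γ = α` gives the subtracted one.
  fin_cases α
  · simp only [Fin.zero_eta, hK1, hG1, hdK1, hT1]
    linear_combination hD.1.1.1 + hD.2.2.1 - (1 / 2 : ℝ) * (hD.1.1.1 + hD.1.2.2)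
  · simp only [Fin.mk_one, hK1, hG1, hdK1, hT1]
    linear_combination hD.1.1.2 + hD.2.2.2 - (1 / 2 : ℝ) * (hD.2.1.1 + hD.2.2.2)

section Submersion

variable {F : Coord 3 → Coord 2} {K : Coord 2 → Matrix (Fin 2) (Fin 2) ℝ} {p : Coord 3}

theorem contDiffAt_component (hF : ContDiffAt ℝ ∞ F p) (α : Fin 2) :
    ContDiffAt ℝ ∞ (fun v => F v α) p :=
  (EuclideanSpace.proj α : Coord 2 →L[ℝ] ℝ).contDiff.contDiffAt.comp p hF

theorem fderiv_comp_eq_sum {k : Coord 2 → ℝ} (hF : ContDiffAt ℝ ∞ F p)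
    (hk : DifferentiableAt ℝ k (F p)) (X : Coord 3) :
    fderiv ℝ (fun v => k (F v)) p X
      = ∑ l, pderiv l k (F p) * fderiv ℝ (fun v => F v l) p X := by
  have hFd : DifferentiableAt ℝ F p := hF.differentiableAt (by simp)
  have hc := (hk.hasFDerivAt.comp p hFd.hasFDerivAt).fderiv
  change fderiv ℝ (k ∘ F) p X = _
  rw [hc]
  change fderiv ℝ k (F p) (fderiv ℝ F p X) = _
  rw [fderiv_eq_sum_pderiv]
  refine Finset.sum_congr rfl fun l _ => ?_
  rw [fderiv_component hFd, mul_comm]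

/-- Product and chain rules applied to the locally constant matrix `K(F) * G`. The direction `X` is
left free: gradients give the horizontal trace, vertical vectors give constancy of `G` along fibres.
-/
theorem sum_fderiv_mul_eq_zero (hF : ContDiffAt ℝ ∞ F p)
    (hK : ∀ i j, DifferentiableAt ℝ (fun y => K y i j) (F p))
    (hKG : ∀ᶠ v in nhds p, K (F v) * solGramMatrix F v = 1) (X : Coord 3) (β δ : Fin 2) :
    ∑ s, ((∑ l, pderiv l (fun y => K y β s) (F p) * fderiv ℝ (fun v => F v l) p X)
        * solGramMatrix F p s δ
      + K (F p) β s * fderiv ℝ (solGram (fun v => F v s) (fun v => F v δ)) p X) = 0 := by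
  have hFd : DifferentiableAt ℝ F p := hF.differentiableAt (by simp)
  have hKF : ∀ s, DifferentiableAt ℝ (fun v => K (F v) β s) p :=
    fun s => (hK β s).comp p hFd
  have hG : ∀ s, DifferentiableAt ℝ (solGram (fun v => F v s) (fun v => F v δ)) p := fun s =>
    (contDiffAt_solGram (contDiffAt_component hF s)
      (contDiffAt_component hF δ)).differentiableAt (by simp)
  have hconst : (fun v => ∑ s, K (F v) β s * solGram (fun v => F v s) (fun v => F v δ) v)
      =ᶠ[nhds p] fun _ => (1 : Matrix (Fin 2) (Fin 2) ℝ) β δ := by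
    filter_upwards [hKG] with v hv
    rw [← hv]
    rfl
  have hder := congrArg (fun L : Coord 3 →L[ℝ] ℝ => L X) hconst.fderiv_eq
  simp only [fderiv_fun_const, Pi.zero_apply, zero_apply] at hder
  rw [fderiv_fun_sum fun s _ => (hKF s).fun_mul (hG s)] at hder
  rw [← hder, sum_apply]
  refine Finset.sum_congr rfl fun s _ => ?_
  rw [fderiv_fun_mul (hKF s) (hG s), ← fderiv_comp_eq_sum hF (hK β s)]
  simp only [add_apply, smul_apply, smul_eq_mul, solGramMatrix, Matrix.of_apply]
  ring

/-- The derivative of the Gram matrix in a vertical direction vanishes. -/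
theorem fderiv_solGram_vertical (hF : ContDiffAt ℝ ∞ F p)
    (hK : ∀ i j, DifferentiableAt ℝ (fun y => K y i j) (F p))
    (hKG : ∀ᶠ v in nhds p, K (F v) * solGramMatrix F v = 1) {V : Coord 3}
    (hV : ∀ α, fderiv ℝ (fun v => F v α) p V = 0) (α β : Fin 2) :
    fderiv ℝ (solGram (fun v => F v α) (fun v => F v β)) p V = 0 := by
  have h := sum_fderiv_mul_eq_zero hF hK hKG V
  simp only [hV, mul_zero, Finset.sum_const_zero, zero_mul, zero_add] at h
  set D : Matrix (Fin 2) (Fin 2) ℝ := Matrix.of fun s δ =>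
    fderiv ℝ (solGram (fun v => F v s) (fun v => F v δ)) p V with hD
  have hKD : K (F p) * D = 0 := by
    ext β δ
    exact h β δ
  have hGK : solGramMatrix F p * K (F p) = 1 := mul_eq_one_comm.1 hKG.self_of_nhds
  have : D = 0 := by
    rw [← Matrix.one_mul D, ← hGK, Matrix.mul_assoc, hKD, Matrix.mul_zero]
  exact congrFun (congrFun this α) β

theorem solGramMatrix_symm (i j : Fin 2) : solGramMatrix F p i j = solGramMatrix F p j i :=
  solGram_comm _ _ _

/-- The second fundamental form of a Riemannian submersion vanishes on horizontal vectors. -/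
theorem sum_christoffel_mul_solGram (hF : ContDiffAt ℝ ∞ F p)
    (hK : ∀ i j, DifferentiableAt ℝ (fun y => K y i j) (F p))
    (hKs : ∀ y i j, K y i j = K y j i)
    (hKG : ∀ᶠ v in nhds p, K (F v) * solGramMatrix F v = 1) (α : Fin 2) :
    ∑ β, ∑ γ, ((1 / 2 : ℝ) * ∑ l, solGramMatrix F p α l *
        (pderiv β (fun y => K y γ l) (F p) + pderiv γ (fun y => K y β l) (F p)
          - pderiv l (fun y => K y β γ) (F p))) * solGramMatrix F p β γ
      = -∑ β, ∑ γ, K (F p) β γ * solHessForm (fun v => F v α) p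
          (solGrad (fun v => F v β) p) (solGrad (fun v => F v γ) p) := by
  refine christoffel_contraction (dK := fun l i j => pderiv l (fun y => K y i j) (F p))
    (T := fun α β γ => solHessForm (fun v => F v α) p
      (solGrad (fun v => F v β) p) (solGrad (fun v => F v γ) p)) (hKs (F p))
    solGramMatrix_symm (fun l i j => ?_)
    (fun l i j => solHessForm_symm (contDiffAt_component hF l) _ _) (fun γ β δ => ?_) α
  · simp only [hKs _ i j]
  · have h := sum_fderiv_mul_eq_zero hF hK hKG (solGrad (fun v => F v γ) p) β δ
    simp only [fderiv_solGrad, fderiv_solGram (contDiffAt_component hF _)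
      (contDiffAt_component hF _)] at h
    exact h

end Submersion

/-! ### The unit vertical field and geodesic fibres. -/

/-- The unit vertical vector field of a submersion `F` from Sol space. -/
def unitVertical (F : Coord 3 → Coord 2) (i : Fin 3) (p : Coord 3) : ℝ :=
  solCross F p i / √(solGramMatrix F p).det

section Vertical

variable {F : Coord 3 → Coord 2} {p : Coord 3}

theorem contDiffAt_unitVertical (hF : ContDiffAt ℝ ∞ F p) (hd : 0 < (solGramMatrix F p).det)
    (i : Fin 3) : ContDiffAt ℝ ∞ (unitVertical F i) p := by
  have hc := fun (α : Fin 2) (j : Fin 3) => contDiffAt_pderiv (contDiffAt_component hF α) j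
  have hg := fun (α β : Fin 2) => contDiffAt_solGram (contDiffAt_component hF α)
    (contDiffAt_component hF β)
  have hW : ContDiffAt ℝ ∞ (fun v => solCross F v i) p := by
    fin_cases i
    · exact ((hc 0 1).mul (hc 1 2)).sub ((hc 0 2).mul (hc 1 1))
    · exact ((hc 0 2).mul (hc 1 0)).sub ((hc 0 0).mul (hc 1 2))
    · exact ((hc 0 0).mul (hc 1 1)).sub ((hc 0 1).mul (hc 1 0))
  have hdet : ContDiffAt ℝ ∞ (fun v => (solGramMatrix F v).det) p := by
    simp only [Matrix.det_fin_two]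
    exact ((hg 0 0).mul (hg 1 1)).sub ((hg 0 1).mul (hg 1 0))
  exact hW.div (hdet.sqrt hd.ne') (Real.sqrt_pos.2 hd).ne'

theorem unitVertical_unit (hd : 0 < (solGramMatrix F p).det) :
    Real.exp (2 * p 2) * unitVertical F 0 p ^ 2
      + Real.exp (-(2 * p 2)) * unitVertical F 1 p ^ 2 + unitVertical F 2 p ^ 2 = 1 := by
  simp only [unitVertical, div_pow, Real.sq_sqrt hd.le]
  have h := det_solGramMatrix F p
  field_simp
  linarith

theorem sum_pderiv_mul_unitVertical (α : Fin 2) :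
    ∑ i, pderiv i (fun v => F v α) p * unitVertical F i p = 0 := by
  rw [Fin.sum_univ_three]
  simp only [unitVertical, solCross, Matrix.cons_val]
  fin_cases α
  · simp only [Fin.zero_eta]
    ring
  · simp only [Fin.mk_one]
    ring

/-- The Sol cometric in the orthogonal splitting into vertical and horizontal vectors. -/
theorem cometric_splitting {K : Matrix (Fin 2) (Fin 2) ℝ} (hd : 0 < (solGramMatrix F p).det)
    (hKG : K * solGramMatrix F p = 1) (i j : Fin 3) :
    (Matrix.diagonal ![Real.exp (-(2 * p 2)), Real.exp (2 * p 2), 1] : Matrix _ _ ℝ) i j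
      = unitVertical F i p * unitVertical F j p
        + ∑ β, ∑ γ, K β γ * solGrad (fun v => F v β) p i * solGrad (fun v => F v γ) p j := by
  set d := (solGramMatrix F p).det with hdd
  -- Scaling by `d` replaces `K = G⁻¹` by the adjugate and removes the square roots from the product
  -- of the two components of `V`, leaving an algebraic identity.
  have hKd : d • K = (solGramMatrix F p).adjugate := by
    rw [← Matrix.one_mul (solGramMatrix F p).adjugate, ← hKG, Matrix.mul_assoc,
      Matrix.mul_adjugate, Matrix.mul_smul, Matrix.mul_one]
  have hV : d * (unitVertical F i p * unitVertical F j p) = solCross F p i * solCross F p j := by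
    have hs := Real.mul_self_sqrt hd.le
    have hs0 := (Real.sqrt_pos.2 hd).ne'
    simp only [unitVertical, ← hdd]
    field_simp
    linear_combination -(solCross F p i * solCross F p j) * hs
  have hk : ∀ β γ, d * K β γ = (solGramMatrix F p).adjugate β γ :=
    fun β γ => congrFun (congrFun hKd β) γ
  have hE := (Real.exp_pos (2 * p 2)).ne'
  refine mul_left_cancel₀ hd.ne' ?_
  rw [mul_add, hV]
  simp only [Finset.mul_sum, ← mul_assoc, hk]
  rw [Matrix.adjugate_fin_two, hdd, det_solGramMatrix]
  simp only [Fin.sum_univ_two, solGramMatrix, solGram, Matrix.of_apply, solGrad, solCross,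
    Real.exp_neg]
  fin_cases i <;> fin_cases j <;> simp <;> field_simp <;> ring

/-- The Sol Hessians of the components of a harmonic Riemannian submersion vanish on vertical
vectors. -/
theorem sum_solHess_unitVertical {K : Coord 2 → Matrix (Fin 2) (Fin 2) ℝ}
    (hF : ContDiffAt ℝ ∞ F p)
    (hd : 0 < (solGramMatrix F p).det)
    (hK : ∀ i j, DifferentiableAt ℝ (fun y => K y i j) (F p))
    (hKs : ∀ y i j, K y i j = K y j i)
    (hKG : ∀ᶠ v in nhds p, K (F v) * solGramMatrix F v = 1) (α : Fin 2)
    (ht : Real.exp (-(2 * p 2)) * solHess (fun v => F v α) p 0 0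
          + Real.exp (2 * p 2) * solHess (fun v => F v α) p 1 1
          + solHess (fun v => F v α) p 2 2
        + ∑ β, ∑ γ, ((1 / 2 : ℝ) * ∑ l, solGramMatrix F p α l *
        (pderiv β (fun y => K y γ l) (F p) + pderiv γ (fun y => K y β l) (F p)
          - pderiv l (fun y => K y β γ) (F p))) * solGramMatrix F p β γ = 0) :
    ∑ i, ∑ j, solHess (fun v => F v α) p i j * unitVertical F i p * unitVertical F j p = 0 := by
  rw [sum_christoffel_mul_solGram hF hK hKs hKG] at ht
  have hsplit := cometric_splitting hd hKG.self_of_nhds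
  have htr : Real.exp (-(2 * p 2)) * solHess (fun v => F v α) p 0 0
          + Real.exp (2 * p 2) * solHess (fun v => F v α) p 1 1
          + solHess (fun v => F v α) p 2 2
      = ∑ i, ∑ j, solHess (fun v => F v α) p i j *
        (Matrix.diagonal ![Real.exp (-(2 * p 2)), Real.exp (2 * p 2), 1] : Matrix _ _ ℝ) i j := by
    simp [Fin.sum_univ_three, Matrix.diagonal_apply]
    ring
  -- The Laplacian of `Fᵅ` is the Hessian contracted with the cometric. After splitting the
  -- cometric, its horizontal part cancels the Christoffel term and only `Hess Fᵅ(V, V)` remains.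
  rw [htr] at ht
  simp only [hsplit] at ht
  rw [← ht]
  simp only [solHessForm, Fin.sum_univ_three, Fin.sum_univ_two]
  ring

end Vertical

/-! ### The unit vertical field is Killing. -/

section Killing

variable {F : Coord 3 → Coord 2} {p : Coord 3}

/-- The Lie derivative of the Sol metric along the unit vertical vector field. -/
def lieMetric (F : Coord 3 → Coord 2) (p : Coord 3) : Matrix (Fin 3) (Fin 3) ℝ :=
  !![2 * Real.exp (2 * p 2) * (unitVertical F 2 p + pderiv 0 (unitVertical F 0) p),
      Real.exp (-(2 * p 2)) * pderiv 0 (unitVertical F 1) p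
        + Real.exp (2 * p 2) * pderiv 1 (unitVertical F 0) p,
      pderiv 0 (unitVertical F 2) p + Real.exp (2 * p 2) * pderiv 2 (unitVertical F 0) p;
    Real.exp (-(2 * p 2)) * pderiv 0 (unitVertical F 1) p
        + Real.exp (2 * p 2) * pderiv 1 (unitVertical F 0) p,
      2 * Real.exp (-(2 * p 2)) * (pderiv 1 (unitVertical F 1) p - unitVertical F 2 p),
      pderiv 1 (unitVertical F 2) p + Real.exp (-(2 * p 2)) * pderiv 2 (unitVertical F 1) p;
    pderiv 0 (unitVertical F 2) p + Real.exp (2 * p 2) * pderiv 2 (unitVertical F 0) p,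
      pderiv 1 (unitVertical F 2) p + Real.exp (-(2 * p 2)) * pderiv 2 (unitVertical F 1) p,
      2 * pderiv 2 (unitVertical F 2) p]

theorem lieMetric_symm (i j : Fin 3) : lieMetric F p i j = lieMetric F p j i := by
  fin_cases i <;> fin_cases j <;> rfl

/-- A covector that kills `V` and both gradients is killed by the split cometric, which is
invertible. -/
theorem eq_zero_of_splitting {K : Matrix (Fin 2) (Fin 2) ℝ} (hd : 0 < (solGramMatrix F p).det)
    (hKG : K * solGramMatrix F p = 1) {y : Fin 3 → ℝ}
    (hV : ∑ j, y j * unitVertical F j p = 0)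
    (hX : ∀ γ, ∑ j, y j * solGrad (fun v => F v γ) p j = 0) : y = 0 := by
  funext i
  have hsum : ∑ j, (Matrix.diagonal ![Real.exp (-(2 * p 2)), Real.exp (2 * p 2), 1] :
      Matrix _ _ ℝ) i j * y j = 0 := by
    simp only [cometric_splitting hd hKG]
    have h0 := hX 0
    have h1 := hX 1
    simp only [Fin.sum_univ_three, Fin.sum_univ_two] at hV h0 h1 ⊢
    linear_combination unitVertical F i p * hV
      + (K 0 0 * solGrad (fun v => F v 0) p i + K 1 0 * solGrad (fun v => F v 1) p i) * h0
      + (K 0 1 * solGrad (fun v => F v 0) p i + K 1 1 * solGrad (fun v => F v 1) p i) * h1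
  simp only [Matrix.diagonal_apply, ite_mul, zero_mul, Finset.sum_ite_eq, Finset.mem_univ,
    if_true] at hsum
  refine (mul_eq_zero.1 hsum).resolve_left ?_
  fin_cases i <;> simp

theorem pderiv_unit (hF : ContDiffAt ℝ ∞ F p)
    (hd : ∀ᶠ v in nhds p, 0 < (solGramMatrix F v).det) (k : Fin 3) :
    Real.exp (2 * p 2) * unitVertical F 0 p * pderiv k (unitVertical F 0) p
      + Real.exp (-(2 * p 2)) * unitVertical F 1 p * pderiv k (unitVertical F 1) p
      + unitVertical F 2 p * pderiv k (unitVertical F 2) p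
      + (if k = 2 then Real.exp (2 * p 2) * unitVertical F 0 p ^ 2
          - Real.exp (-(2 * p 2)) * unitVertical F 1 p ^ 2 else 0) = 0 := by
  have dV : ∀ i, DifferentiableAt ℝ (unitVertical F i) p :=
    fun i => (contDiffAt_unitVertical hF hd.self_of_nhds i).differentiableAt (by simp)
  have dVV : ∀ i, DifferentiableAt ℝ (fun v => unitVertical F i v * unitVertical F i v) p :=
    fun i => (dV i).fun_mul (dV i)
  have d0 := (differentiableAt_expPos p).fun_mul (dVV 0)
  have d1 := (differentiableAt_expNeg p).fun_mul (dVV 1)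
  have hev : (fun v => Real.exp (2 * v 2) * (unitVertical F 0 v * unitVertical F 0 v)
      + Real.exp (-(2 * v 2)) * (unitVertical F 1 v * unitVertical F 1 v)
      + unitVertical F 2 v * unitVertical F 2 v) =ᶠ[nhds p] fun _ => 1 := by
    filter_upwards [hd] with v hv
    rw [← unitVertical_unit hv]
    ring
  have h := pderiv_congr hev k
  rw [pderiv_const, pderiv_add (d0.fun_add d1) (dVV 2), pderiv_add d0 d1,
    pderiv_mul (differentiableAt_expPos p) (dVV 0), pderiv_mul (differentiableAt_expNeg p) (dVV 1),
    pderiv_mul (dV 0) (dV 0), pderiv_mul (dV 1) (dV 1), pderiv_mul (dV 2) (dV 2),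
    pderiv_expPos, pderiv_expNeg] at h
  split_ifs at h ⊢
  · linear_combination (1 / 2 : ℝ) * h
  · linear_combination (1 / 2 : ℝ) * h

theorem pderiv_perp (hF : ContDiffAt ℝ ∞ F p) (hd : 0 < (solGramMatrix F p).det)
    (α : Fin 2) (k : Fin 3) :
    ∑ i, (pderiv k (pderiv i fun v => F v α) p * unitVertical F i p
      + pderiv i (fun v => F v α) p * pderiv k (unitVertical F i) p) = 0 := by
  have dV : ∀ i, DifferentiableAt ℝ (unitVertical F i) p :=
    fun i => (contDiffAt_unitVertical hF hd i).differentiableAt (by simp)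
  have da : ∀ i, DifferentiableAt ℝ (pderiv i fun v => F v α) p :=
    fun i => (contDiffAt_pderiv (contDiffAt_component hF α) i).differentiableAt (by simp)
  have hz : (fun v => ∑ i, pderiv i (fun v => F v α) v * unitVertical F i v) = fun _ => 0 :=
    funext fun v => sum_pderiv_mul_unitVertical α
  have h := congrArg (fun a => pderiv k a p) hz
  simp only [pderiv_const, Fin.sum_univ_three] at h
  rw [pderiv_add (((da 0).fun_mul (dV 0)).fun_add ((da 1).fun_mul (dV 1)))
      ((da 2).fun_mul (dV 2)),
    pderiv_add ((da 0).fun_mul (dV 0)) ((da 1).fun_mul (dV 1)),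
    pderiv_mul (da 0) (dV 0), pderiv_mul (da 1) (dV 1), pderiv_mul (da 2) (dV 2)] at h
  rw [Fin.sum_univ_three]
  linear_combination h

theorem lieMetric_vertical_vertical (hF : ContDiffAt ℝ ∞ F p)
    (hd : ∀ᶠ v in nhds p, 0 < (solGramMatrix F v).det) :
    ∑ i, (∑ j, lieMetric F p i j * unitVertical F j p) * unitVertical F i p = 0 := by
  have h0 := pderiv_unit hF hd 0
  have h1 := pderiv_unit hF hd 1
  have h2 := pderiv_unit hF hd 2
  simp only [Fin.sum_univ_three, lieMetric, Matrix.of_apply, Matrix.cons_val]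
  simp at h0 h1 h2
  linear_combination 2 * unitVertical F 0 p * h0 + 2 * unitVertical F 1 p * h1
    + 2 * unitVertical F 2 p * h2

/-- For `X = ∇Fᵅ` and unit `V`, `(L_V g)(X, V) = ⟨X, ∇_V V⟩ = dFᵅ(∇_V V)`. Since `dFᵅ(V) = 0`, this
is `-Hess Fᵅ(V, V)`. -/
theorem lieMetric_horizontal_vertical (hF : ContDiffAt ℝ ∞ F p)
    (hd : ∀ᶠ v in nhds p, 0 < (solGramMatrix F v).det) (α : Fin 2)
    (hH : ∑ i, ∑ j, solHess (fun v => F v α) p i j * unitVertical F i p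
      * unitVertical F j p = 0) :
    ∑ i, (∑ j, lieMetric F p i j * unitVertical F j p) * solGrad (fun v => F v α) p i = 0 := by
  have h0 := pderiv_unit hF hd 0
  have h1 := pderiv_unit hF hd 1
  have h2 := pderiv_unit hF hd 2
  have k0 := pderiv_perp hF hd.self_of_nhds α 0
  have k1 := pderiv_perp hF hd.self_of_nhds α 1
  have k2 := pderiv_perp hF hd.self_of_nhds α 2
  have hE := exp_mul_exp_neg (2 * p 2)
  simp only [Fin.sum_univ_three, lieMetric, solHess, Matrix.of_apply, Matrix.cons_val, solGrad]
    at hH k0 k1 k2 ⊢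
  simp at h0 h1 h2
  rw [Real.exp_neg] at *
  have hne := (Real.exp_pos (2 * p 2)).ne'
  set E := Real.exp (2 * p 2)
  linear_combination (norm := (field_simp; ring)) unitVertical F 0 p * k0 + unitVertical F 1 p * k1
    + unitVertical F 2 p * k2 - hH + E⁻¹ * pderiv 0 (fun v => F v α) p * h0
    + E * pderiv 1 (fun v => F v α) p * h1 + pderiv 2 (fun v => F v α) p * h2

/-- Differentiating `dF(V) = 0` turns `(L_V g)(∇Fᵅ, ∇Fᵝ)` into `-Hess Fᵝ(∇Fᵅ, V) - Hess Fᵅ(∇Fᵝ, V)`,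
which is minus the derivative of `⟨∇Fᵅ, ∇Fᵝ⟩` along `V`. -/
theorem lieMetric_horizontal_horizontal (hF : ContDiffAt ℝ ∞ F p)
    (hd : 0 < (solGramMatrix F p).det) (α β : Fin 2)
    (hG : ∑ k, unitVertical F k p * pderiv k (solGram (fun v => F v α) (fun v => F v β)) p = 0) :
    ∑ i, (∑ j, lieMetric F p i j * solGrad (fun v => F v β) p j)
      * solGrad (fun v => F v α) p i = 0 := by
  have k0 := pderiv_perp hF hd α 0
  have k1 := pderiv_perp hF hd α 1
  have k2 := pderiv_perp hF hd α 2
  have l0 := pderiv_perp hF hd β 0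
  have l1 := pderiv_perp hF hd β 1
  have l2 := pderiv_perp hF hd β 2
  simp only [pderiv_solGram (contDiffAt_component hF α) (contDiffAt_component hF β)] at hG
  have sa := pderiv_comm (contDiffAt_component hF α)
  have sb := pderiv_comm (contDiffAt_component hF β)
  simp only [Fin.sum_univ_three, lieMetric, solHess, Matrix.of_apply, Matrix.cons_val, solGrad]
    at hG k0 k1 k2 l0 l1 l2 ⊢
  rw [Real.exp_neg] at *
  rw [sa 1 0, sa 2 0, sa 2 1, sb 1 0, sb 2 0, sb 2 1] at hG
  rw [sa 1 0] at k1
  rw [sa 2 0, sa 2 1] at k2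
  rw [sb 1 0] at l1
  rw [sb 2 0, sb 2 1] at l2
  have hne := (Real.exp_pos (2 * p 2)).ne'
  set E := Real.exp (2 * p 2)
  linear_combination (norm := (field_simp; ring))
    E⁻¹ * pderiv 0 (fun v => F v β) p * k0 + E * pderiv 1 (fun v => F v β) p * k1
    + pderiv 2 (fun v => F v β) p * k2 + E⁻¹ * pderiv 0 (fun v => F v α) p * l0
    + E * pderiv 1 (fun v => F v α) p * l1 + pderiv 2 (fun v => F v α) p * l2 - hG

/-- If the Sol Hessians of the components vanish on vertical vectors, the unit vertical vector
field is a Killing field. -/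
theorem lieMetric_eq_zero {K : Coord 2 → Matrix (Fin 2) (Fin 2) ℝ} (hF : ContDiffAt ℝ ∞ F p)
    (hd : ∀ᶠ v in nhds p, 0 < (solGramMatrix F v).det)
    (hK : ∀ i j, DifferentiableAt ℝ (fun y => K y i j) (F p))
    (hKG : ∀ᶠ v in nhds p, K (F v) * solGramMatrix F v = 1)
    (hH : ∀ α, ∑ i, ∑ j, solHess (fun v => F v α) p i j * unitVertical F i p
      * unitVertical F j p = 0) : lieMetric F p = 0 := by
  have hdp := hd.self_of_nhds
  have hKGp := hKG.self_of_nhds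
  set V : Coord 3 := WithLp.toLp 2 fun i => unitVertical F i p with hVdef
  have hG : ∀ α β, ∑ k, unitVertical F k p
      * pderiv k (solGram (fun v => F v α) (fun v => F v β)) p = 0 := by
    intro α β
    rw [← fderiv_solGram_vertical hF hK hKG (V := V) (fun α => ?_) α β, fderiv_eq_sum_pderiv]
    rw [fderiv_eq_sum_pderiv, ← sum_pderiv_mul_unitVertical (F := F) (p := p) α]
    exact Finset.sum_congr rfl fun i _ => mul_comm _ _
  have hV : (fun i => ∑ j, lieMetric F p i j * unitVertical F j p) = 0 :=
    eq_zero_of_splitting hdp hKGp (lieMetric_vertical_vertical hF hd)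
      fun α => lieMetric_horizontal_vertical hF hd α (hH α)
  have hX : ∀ β, (fun i => ∑ j, lieMetric F p i j * solGrad (fun v => F v β) p j) = 0 := by
    intro β
    refine eq_zero_of_splitting hdp hKGp ?_
      fun α => lieMetric_horizontal_horizontal hF hdp α β (hG α β)
    rw [← lieMetric_horizontal_vertical hF hd β (hH β)]
    simp only [Finset.sum_mul]
    rw [Finset.sum_comm]
    refine Finset.sum_congr rfl fun i _ => Finset.sum_congr rfl fun j _ => ?_
    rw [lieMetric_symm]
    ring
  ext i j
  exact congrFun (eq_zero_of_splitting (y := fun j => lieMetric F p i j) hdp hKGp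
    (congrFun hV i) fun β => congrFun (hX β) i) j

end Killing

/-! ### Nonexistence of local unit Killing fields on Sol. -/

/-- Sol space carries no local unit Killing field. -/
theorem no_unit_killing {U : Set (Coord 3)} (hU : IsOpen U) (hne : U.Nonempty)
    {V : Fin 3 → Coord 3 → ℝ} (hV : ∀ i, ∀ p ∈ U, ContDiffAt ℝ ∞ (V i) p)
    (hunit : ∀ p ∈ U, Real.exp (2 * p 2) * V 0 p ^ 2 + Real.exp (-(2 * p 2)) * V 1 p ^ 2
      + V 2 p ^ 2 = 1)
    (h00 : ∀ p ∈ U, V 2 p + pderiv 0 (V 0) p = 0)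
    (h02 : ∀ p ∈ U, pderiv 0 (V 2) p + Real.exp (2 * p 2) * pderiv 2 (V 0) p = 0)
    (h12 : ∀ p ∈ U, pderiv 1 (V 2) p + Real.exp (-(2 * p 2)) * pderiv 2 (V 1) p = 0)
    (h22 : ∀ p ∈ U, pderiv 2 (V 2) p = 0) : False := by
  have dV : ∀ i, ∀ p ∈ U, DifferentiableAt ℝ (V i) p :=
    fun i p hp => (hV i p hp).differentiableAt (by simp)
  have dW : ∀ i, ∀ p ∈ U, DifferentiableAt ℝ (pderiv i (V 2)) p :=
    fun i p hp => (contDiffAt_pderiv (hV 2 p hp) i).differentiableAt (by simp)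
  have hWz : ∀ i, ∀ p ∈ U, pderiv 2 (pderiv i (V 2)) p = 0 := by
    intro i p hp
    have hev : pderiv 2 (V 2) =ᶠ[nhds p] fun _ => 0 := by
      filter_upwards [hU.mem_nhds hp] with q hq using h22 q hq
    rw [pderiv_comm (hV 2 p hp), pderiv_congr hev, pderiv_const]
  have h20 : ∀ p ∈ U, pderiv 2 (V 0) p = -(Real.exp (-(2 * p 2)) * pderiv 0 (V 2) p) := by
    intro p hp
    linear_combination Real.exp (-(2 * p 2)) * h02 p hp
      - pderiv 2 (V 0) p * exp_mul_exp_neg (2 * p 2)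
  have h21 : ∀ p ∈ U, pderiv 2 (V 1) p = -(Real.exp (2 * p 2) * pderiv 1 (V 2) p) := by
    intro p hp
    linear_combination Real.exp (2 * p 2) * h12 p hp
      - pderiv 2 (V 1) p * exp_mul_exp_neg (2 * p 2)
  -- Half the `z`-derivative of `|V|² = 1`, with the `z`-derivatives of `V 0` and `V 1` eliminated
  -- by the Killing equations.
  have hfirst : ∀ p ∈ U, Real.exp (2 * p 2) * (V 0 p * V 0 p) - V 0 p * pderiv 0 (V 2) p
      + (-1) * (Real.exp (-(2 * p 2)) * (V 1 p * V 1 p)) + (-1) * (V 1 p * pderiv 1 (V 2) p)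
        = 0 := by
    intro p hp
    have d00 := (dV 0 p hp).fun_mul (dV 0 p hp)
    have d11 := (dV 1 p hp).fun_mul (dV 1 p hp)
    have d22 := (dV 2 p hp).fun_mul (dV 2 p hp)
    have e0 := (differentiableAt_expPos p).fun_mul d00
    have e1 := (differentiableAt_expNeg p).fun_mul d11
    have hev : (fun q => Real.exp (2 * q 2) * (V 0 q * V 0 q)
        + Real.exp (-(2 * q 2)) * (V 1 q * V 1 q) + V 2 q * V 2 q) =ᶠ[nhds p] fun _ => 1 := by
      filter_upwards [hU.mem_nhds hp] with q hq
      rw [← hunit q hq]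
      ring
    have h := pderiv_congr hev 2
    rw [pderiv_const, pderiv_add (e0.fun_add e1) d22, pderiv_add e0 e1,
      pderiv_mul (differentiableAt_expPos p) d00, pderiv_mul (differentiableAt_expNeg p) d11,
      pderiv_mul (dV 0 p hp) (dV 0 p hp), pderiv_mul (dV 1 p hp) (dV 1 p hp),
      pderiv_mul (dV 2 p hp) (dV 2 p hp), pderiv_expPos, pderiv_expNeg, h20 p hp, h21 p hp,
      h22 p hp, if_pos rfl, if_pos rfl] at h
    linear_combination (1 / 2 : ℝ) * h + (V 0 p * pderiv 0 (V 2) p + V 1 p * pderiv 1 (V 2) p)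
      * exp_mul_exp_neg (2 * p 2)
  have hzero : ∀ p ∈ U, V 0 p = 0 ∧ V 1 p = 0 := by
    intro p hp
    have d00 := (dV 0 p hp).fun_mul (dV 0 p hp)
    have d11 := (dV 1 p hp).fun_mul (dV 1 p hp)
    have e0 := (differentiableAt_expPos p).fun_mul d00
    have e1 := (differentiableAt_expNeg p).fun_mul d11
    have g0 := (dV 0 p hp).fun_mul (dW 0 p hp)
    have g1 := (dV 1 p hp).fun_mul (dW 1 p hp)
    have hc := differentiableAt_const (𝕜 := ℝ) (x := p) (-1 : ℝ)
    have hev : (fun q => Real.exp (2 * q 2) * (V 0 q * V 0 q)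
        + (-1) * (V 0 q * pderiv 0 (V 2) q)
        + ((-1) * (Real.exp (-(2 * q 2)) * (V 1 q * V 1 q))
          + (-1) * (V 1 q * pderiv 1 (V 2) q))) =ᶠ[nhds p] fun _ => 0 := by
      filter_upwards [hU.mem_nhds hp] with q hq
      rw [← hfirst q hq]
      ring
    have h := pderiv_congr hev 2
    rw [pderiv_const, pderiv_add (e0.fun_add (hc.fun_mul g0))
        ((hc.fun_mul e1).fun_add (hc.fun_mul g1)), pderiv_add e0 (hc.fun_mul g0),
      pderiv_add (hc.fun_mul e1) (hc.fun_mul g1), pderiv_mul hc g0, pderiv_mul hc e1,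
      pderiv_mul hc g1,
      pderiv_mul (differentiableAt_expPos p) d00, pderiv_mul (differentiableAt_expNeg p) d11,
      pderiv_mul (dV 0 p hp) (dV 0 p hp), pderiv_mul (dV 1 p hp) (dV 1 p hp),
      pderiv_mul (dV 0 p hp) (dW 0 p hp), pderiv_mul (dV 1 p hp) (dW 1 p hp),
      pderiv_expPos, pderiv_expNeg, h20 p hp, h21 p hp, hWz 0 p hp, hWz 1 p hp, pderiv_const,
      if_pos rfl, if_pos rfl] at h
    have hE := Real.exp_pos (2 * p 2)
    have hE' := Real.exp_pos (-(2 * p 2))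
    have hEE := exp_mul_exp_neg (2 * p 2)
    set E := Real.exp (2 * p 2)
    set E' := Real.exp (-(2 * p 2))
    -- The `z`-derivative of `hfirst`, where `∂₀V₂` and `∂₁V₂` are constant in `z` by `hWz`;
    -- completing squares leaves four nonnegative terms.
    have hsum : E * V 0 p ^ 2 + E * (V 0 p - E' * pderiv 0 (V 2) p) ^ 2
        + E' * V 1 p ^ 2 + E' * (V 1 p + E * pderiv 1 (V 2) p) ^ 2 = 0 := by
      linear_combination h + (E' * pderiv 0 (V 2) p ^ 2 + E * pderiv 1 (V 2) p ^ 2) * hEE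
    have p0 : 0 ≤ E * V 0 p ^ 2 := by positivity
    have p1 : 0 ≤ E * (V 0 p - E' * pderiv 0 (V 2) p) ^ 2 := by positivity
    have p2 : 0 ≤ E' * V 1 p ^ 2 := by positivity
    have p3 : 0 ≤ E' * (V 1 p + E * pderiv 1 (V 2) p) ^ 2 := by positivity
    have z0 : E * V 0 p ^ 2 = 0 := by linarith
    have z1 : E' * V 1 p ^ 2 = 0 := by linarith
    exact ⟨by simpa [hE.ne'] using z0, by simpa [hE'.ne'] using z1⟩
  obtain ⟨p, hp⟩ := hne
  -- As `V 0` vanishes on an open set, so does its `x`-derivative; the `00` Killing equation then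
  -- gives `V 2 = 0`, against unit length.
  have hev : V 0 =ᶠ[nhds p] fun _ => 0 := by
    filter_upwards [hU.mem_nhds hp] with q hq using (hzero q hq).1
  have hw := h00 p hp
  rw [pderiv_congr hev, pderiv_const, add_zero] at hw
  have h1 := hunit p hp
  rw [(hzero p hp).1, (hzero p hp).2, hw] at h1
  norm_num at h1

end SolSubmersion

end

/-! ### The main theorem. -/

open SolSubmersion in
/-- There is no harmonic Riemannian submersion from Sol space to a Riemannian surface. -/
theorem theorem2p2 {N : Type*} [TopologicalSpace N] [ChartedSpace (EuclideanSpace ℝ (Fin 2)) N]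
    [IsManifold (𝓡 2) ∞ N] (h : Metric 2 N) :
    ¬ ∃ φ : EuclideanSpace ℝ (Fin 3) → N,
      IsRiemannianSubmersion solMetric h φ ∧ IsHarmonicMap solMetric h φ := by
  rintro ⟨φ, hφ, hharm⟩
  set e' := chartAt (Coord 2) (φ 0) with he'def
  have he' : e' ∈ atlas (Coord 2) N := chart_mem_atlas _ _
  set U : Set (Coord 3) := φ ⁻¹' e'.source with hUdef
  have hU : IsOpen U := hφ.smooth.continuous.isOpen_preimage _ e'.open_source
  set F : Coord 3 → Coord 2 := fun v => e' (φ v) with hFdef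
  have hF : ∀ p ∈ U, ContDiffAt ℝ ∞ F p := fun p hp => contDiffAt_chart_comp he' hφ.smooth hp
  have hd : ∀ p ∈ U, 0 < (solGramMatrix F p).det := fun p hp =>
    det_solGramMatrix_pos ((hF p hp).differentiableAt (by simp))
      (surjective_fderiv_chart_comp he' hφ.smooth hp (hφ.surjective_mfderiv p))
  have hKG : ∀ p ∈ U, metricMatrix h e' (F p) * solGramMatrix F p = 1 :=
    fun p hp => metricMatrix_mul_solGramMatrix he' hφ hp
  have hkill : ∀ p ∈ U, lieMetric F p = 0 := by
    intro p hp
    have hn := hU.mem_nhds hp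
    have hdn : ∀ᶠ v in nhds p, 0 < (solGramMatrix F v).det := by
      filter_upwards [hn] with v hv using hd v hv
    have hKGn : ∀ᶠ v in nhds p, metricMatrix h e' (F v) * solGramMatrix F v = 1 := by
      filter_upwards [hn] with v hv using hKG v hv
    have hK : ∀ i j, DifferentiableAt ℝ (fun y => metricMatrix h e' y i j) (F p) :=
      fun i j => differentiableAt_metricMatrix h he' (e'.map_source hp) i j
    refine lieMetric_eq_zero (hF p hp) hdn hK hKGn fun α => ?_
    refine sum_solHess_unitVertical (hF p hp) (hd p hp) hK (metricMatrix_symm h e') hKGn α ?_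
    -- The identity is the only chart in the atlas of `ℝ³`, hence the `rfl`.
    have ht := hharm.tension_eq_zero (OpenPartialHomeomorph.refl (Coord 3)) rfl e' he' p
      trivial hp α
    rw [OpenPartialHomeomorph.refl_apply, tension_sol] at ht
    -- The inverse metric in the Christoffel symbols of `h` is the Gram matrix, which brings the
    -- tension into the form used by `sum_solHess_unitVertical`.
    have hinv : (metricMatrix h e' (e' (φ p)))⁻¹ = solGramMatrix F p :=
      Matrix.inv_eq_right_inv (hKG p hp)
    simp only [christoffel, id_eq, hinv] at ht
    exact ht
  have hS : ∀ p ∈ U, ∀ i j, lieMetric F p i j = 0 := fun p hp i j => by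
    rw [hkill p hp]
    rfl
  refine no_unit_killing hU ⟨0, mem_chart_source _ _⟩ (V := unitVertical F)
    (fun i p hp => contDiffAt_unitVertical (hF p hp) (hd p hp) i)
    (fun p hp => unitVertical_unit (hd p hp)) (fun p hp => ?_) (fun p hp => hS p hp 0 2)
    (fun p hp => hS p hp 1 2) (fun p hp => ?_)
  · have h00 : 2 * Real.exp (2 * p 2)
        * (unitVertical F 2 p + pderiv 0 (unitVertical F 0) p) = 0 := hS p hp 0 0
    exact (mul_eq_zero.1 h00).resolve_left (by positivity)
  · have h22 : 2 * pderiv 2 (unitVertical F 2) p = 0 := hS p hp 2 2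
    linarith
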